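/- Let $q=2^m$ with $m\ge 4$ even, and let $U_{q+1}=\{u\in\mathrm{GF}(q^2):u^{q+1}=1\}$ be the set of all $(q+1)$-th roots of unity in $\mathrm{GF}(q^2)$. Let $$\mathcal C_{\{3,5\}}=\left\{\left(a_3u^3+a_{q-2}u^{q-2}+a_5u^5+a_{q-4}u^{q-4}\right)_{u\in U_{q+1}} : a_3,a_{q-2},a_5,a_{q-4}\in\mathrm{GF}(q^2)\right\},$$ a linear code over $\mathrm{GF}(q^2)$ with coordinates indexed by $U_{q+1}$. Let $$\mathcal C_{\{3,5\}}^{\perp}=\left\{(w_u)_{u\in U_{q+1}}\in \mathrm{GF}(q^2)^{U_{q+1}} : \sum_{u\in U_{q+1}}c_uw_u=0\ \text{for all } (c_u)_{u\in U_{q+1}}\in\mathcal C_{\{3,5\}}\right\}$$ be its Euclidean dual, and let $\mathcal C_{\{3,5\}}^{\perp}|_{\mathrm{GF}(q)}=\mathcal C_{\{3,5\}}^{\perp}\cap \mathrm{GF}(q)^{U_{q+1}}$ be the subfield subcode of the dual, consisting of the codewords of $\mathcal C_{\{3,5\}}^{\perp}$ all of whose entries lie in $\mathrm{GF}(q)$.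 Then $\mathcal C_{\{3,5\}}^{\perp}|_{\mathrm{GF}(q)}$ is a $[q+1,q-3,4]_q$ code: a linear code over $\mathrm{GF}(q)$ of length $q+1$, dimension $q-3$ over $\mathrm{GF}(q)$, and minimum Hamming distance exactly $4$. -/

import Mathlib

/-- The dual code: all vectors orthogonal to every codeword, with respect to the usual
(Euclidean, not Hermitian) inner product `∑ i, c i * w i`. -/
def dualCode {K ι : Type*} [Field K] [Fintype ι] (C : Submodule K (ι → K)) :
    Submodule K (ι → K) where
  carrier := {w | ∀ c ∈ C, ∑ i, c i * w i = 0}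
  zero_mem' := by
    intro c _
    simp
  add_mem' := by
    intro v w hv hw c hc
    simp only [Pi.add_apply, mul_add, Finset.sum_add_distrib, hv c hc, hw c hc, add_zero]
  smul_mem' := by
    intro a w hw c hc
    simp only [Pi.smul_apply, smul_eq_mul, mul_left_comm (c _) a, ← Finset.mul_sum, hw c hc,
      mul_zero]

/-- The subfield subcode: the codewords of `C` all of whose entries lie in the subfield `F`
of `K`, written as vectors with entries in `F`. -/
def subfieldSubcode (F : Type*) {K ι : Type*} [Field F] [Field K] [Algebra F K]
    (C : Submodule K (ι → K)) : Submodule F (ι → F) where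
  carrier := {c | (fun i => algebraMap F K (c i)) ∈ C}
  zero_mem' := by
    have h : (fun i => algebraMap F K ((0 : ι → F) i)) = 0 := by
      funext i
      simp
    rw [Set.mem_ofPred_eq, h]
    exact C.zero_mem
  add_mem' := by
    intro v w hv hw
    have h : (fun i => algebraMap F K ((v + w) i)) =
        (fun i => algebraMap F K (v i)) + fun i => algebraMap F K (w i) := by
      funext i
      simp
    rw [Set.mem_ofPred_eq, h]
    exact C.add_mem hv hw
  smul_mem' := by
    intro a w hw
    have h : (fun i => algebraMap F K ((a • w) i)) =
        algebraMap F K a • fun i => algebraMap F K (w i) := by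
      funext i
      simp
    rw [Set.mem_ofPred_eq, h]
    exact C.smul_mem (algebraMap F K a) hw

/-- The linear code `C`, with coordinates indexed by `ι` and entries in `F`, is an
`[n, k, d]_r` code: `F` has `r` elements, the length is `n`, the dimension is `k`, and the least
Hamming distance between two distinct codewords is `d`. -/
def HasParameters {F ι : Type*} [Field F] [DecidableEq F] [Fintype ι]
    (C : Submodule F (ι → F)) (n k d r : ℕ) : Prop :=
  Nat.card F = r ∧ Fintype.card ι = n ∧ Module.finrank F C = k ∧
    IsLeast {δ : ℕ | ∃ x ∈ C, ∃ y ∈ C, x ≠ y ∧ hammingDist x y = δ} d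

/-- The code `{(a₃ u ^ 3 + a_{q-2} u ^ (q-2) + a₅ u ^ 5 + a_{q-4} u ^ (q-4))_u}` over `K`, where the
coordinates `u` run over the `(q+1)`-th roots of unity in `K` and the coefficients over `K`. -/
def codeC35 (q : ℕ) (K : Type*) [Field K] :
    Submodule K (rootsOfUnity (q + 1) K → K) where
  carrier := {c | ∃ a₃ a₃' a₅ a₅' : K, ∀ u : rootsOfUnity (q + 1) K,
    c u = a₃ * ((u : Kˣ) : K) ^ 3 + a₃' * ((u : Kˣ) : K) ^ (q - 2)
      + a₅ * ((u : Kˣ) : K) ^ 5 + a₅' * ((u : Kˣ) : K) ^ (q - 4)}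
  zero_mem' := ⟨0, 0, 0, 0, by simp⟩
  add_mem' := by
    rintro v w ⟨a, b, c, d, h⟩ ⟨a', b', c', d', h'⟩
    refine ⟨a + a', b + b', c + c', d + d', fun u => ?_⟩
    rw [Pi.add_apply, h u, h' u]
    ring
  smul_mem' := by
    rintro t w ⟨a, b, c, d, h⟩
    refine ⟨t * a, t * b, t * c, t * d, fun u => ?_⟩
    rw [Pi.smul_apply, smul_eq_mul, h u]
    ring

/-! On the unit circle `u ^ (q + 1) = 1` conjugation `a ↦ a ^ q` is inversion, so a word `w` over
`F` lies in the code iff its power sums with exponents `3` and `5` vanish; those with `-3` and `-5`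
are their conjugates. Multiplying by `u ^ 5` and setting `x = u ^ 2`, a bijection of the circle,
turns the exponents `-5, -3, 3, 5` into `0, 1, 4, 5`.

Dimension: the two sums map words onto `K × K`, of dimension 4 over `F`; a trace functional
vanishing on the image would give a polynomial of degree at most 10 with `q + 1` roots.

Distance: three points with dependent columns would satisfy `z = ω ^ 2 * x + ω * y` for a primitive
cube root of unity `ω`. As `m` is even, `ω` lies in the field of order `q`, and the circle contains
no such triple of distinct points. Four points of cross ratio `ω` annihilate the generalized
Vandermonde determinant; a trace brings the kernel vector down to `F`. -/

/-! ### Points of the unit circle in characteristic two. -/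

/-- Expanding `z * z ^ q = 1` leaves `x * y ^ q + y * x ^ q = 0`; multiplied by `x * y` this is `x ^
2 + y ^ 2 = 0`. -/
theorem eq_of_eq_weighted_sum {K : Type*} [Field K] [CharP K 2] {q : ℕ}
    (hadd : ∀ a b : K, (a + b) ^ q = a ^ q + b ^ q) {ω x y z : K} (hω : ω ^ 2 + ω + 1 = 0)
    (hωq : ω ^ q = ω) (hx : x ^ (q + 1) = 1) (hy : y ^ (q + 1) = 1) (hz : z ^ (q + 1) = 1)
    (h : z = ω ^ 2 * x + ω * y) : x = y := by
  have h2 : (2 : K) = 0 := CharTwo.two_eq_zero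
  have hzq : z ^ q = ω ^ 2 * x ^ q + ω * y ^ q := by
    rw [h, hadd, mul_pow, mul_pow, hωq, ← pow_mul, mul_comm 2 q, pow_mul, hωq]
  rw [pow_succ] at hx hy hz
  rw [hzq] at hz
  have h3 : ω ^ 3 = 1 := by linear_combination (ω - 1) * hω
  generalize x ^ q = X at *
  generalize y ^ q = Y at *
  have h0 : (x + y) ^ 2 = 0 := by grind
  have h1 : x + y = 0 := by simpa using h0
  grind

theorem eq_zero_of_three_power_sums {K : Type*} [Field K] [CharP K 2] {q : ℕ}
    (hq : q % 3 = 1)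
    (hadd : ∀ a b : K, (a + b) ^ q = a ^ q + b ^ q) {a b c x y z : K}
    (hx : x ^ (q + 1) = 1) (hy : y ^ (q + 1) = 1) (hz : z ^ (q + 1) = 1)
    (hxy : x ≠ y) (hxz : x ≠ z) (hyz : y ≠ z)
    (h0 : a + b + c = 0) (h1 : a * x + b * y + c * z = 0)
    (h4 : a * x ^ 4 + b * y ^ 4 + c * z ^ 4 = 0) : c = 0 := by
  have h2 : (2 : K) = 0 := CharTwo.two_eq_zero
  by_contra hc
  have hA : y - x ≠ 0 := sub_ne_zero.2 hxy.symm
  have hB : z - x ≠ 0 := sub_ne_zero.2 hxz.symm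
  have e1 : b * (y - x) + c * (z - x) = 0 := by linear_combination h1 - x * h0
  -- The fourth power is additive in characteristic two.
  have e4 : b * (y - x) ^ 4 + c * (z - x) ^ 4 = 0 := by grind
  have e3 : c * (z - x) * ((z - x) ^ 3 - (y - x) ^ 3) = 0 := by
    linear_combination e4 - (y - x) ^ 3 * e1
  have e5 : (z - x) ^ 3 = (y - x) ^ 3 := by
    have := (mul_eq_zero.1 e3).resolve_left (mul_ne_zero hc hB)
    exact sub_eq_zero.1 this
  obtain ⟨ω, hωdef⟩ : ∃ ω, z - x = ω * (y - x) := ⟨(z - x) / (y - x), by field_simp⟩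
  have h3 : ω ^ 3 = 1 := by
    rw [hωdef, mul_pow] at e5
    exact mul_right_cancel₀ (pow_ne_zero 3 hA) (by rw [e5, one_mul])
  have hne : ω - 1 ≠ 0 := by
    intro h
    apply hyz
    linear_combination -hωdef - (y - x) * h
  have hω : ω ^ 2 + ω + 1 = 0 := by
    have : (ω - 1) * (ω ^ 2 + ω + 1) = 0 := by linear_combination h3
    exact (mul_eq_zero.1 this).resolve_left hne
  have hωq : ω ^ q = ω := by
    rw [← Nat.div_add_mod q 3, hq, pow_add, pow_mul, h3, one_pow, one_mul, pow_one]
  -- Here `z = x + ω * (y - x)`, and `1 - ω = ω ^ 2`.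
  refine hxy (eq_of_eq_weighted_sum hadd hω hωq hx hy hz ?_)
  grind

/-- Three distinct points of the unit circle are completed to a quadruple of cross ratio `ω`. -/
theorem exists_cross_ratio_eq {K : Type*} [Field K] [CharP K 2] {q : ℕ}
    (hadd : ∀ a b : K, (a + b) ^ q = a ^ q + b ^ q) (hqq : ∀ a : K, (a ^ q) ^ q = a)
    {ω x y z : K} (hω : ω ^ 2 + ω + 1 = 0)
    (hωq : ω ^ q = ω) (hx : x ^ (q + 1) = 1) (hy : y ^ (q + 1) = 1) (hz : z ^ (q + 1) = 1)
    (hxy : x ≠ y) (hxz : x ≠ z) (hyz : y ≠ z) :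
    ∃ t : K, t ^ (q + 1) = 1 ∧ t ≠ x ∧ t ≠ y ∧ t ≠ z ∧
      (x - z) * (y - t) = ω * ((y - z) * (x - t)) := by
  have h2 : (2 : K) = 0 := CharTwo.two_eq_zero
  obtain ⟨D, hD⟩ : ∃ D, D = x + ω * y + ω ^ 2 * z := ⟨_, rfl⟩
  have h3 : ω ^ 3 = 1 := by linear_combination (ω - 1) * hω
  have hω0 : ω ≠ 0 := by rintro rfl; simp at h3
  have hω1 : ω ≠ 1 := by rintro rfl; grind
  have hD0 : D ≠ 0 := by
    intro h
    refine hyz.symm (eq_of_eq_weighted_sum hadd hω hωq hz hy hx ?_)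
    grind
  have hDq : D ^ q = x ^ q + ω * y ^ q + ω ^ 2 * z ^ q := by
    rw [hD, hadd, hadd, mul_pow, mul_pow, hωq, ← pow_mul, mul_comm 2 q, pow_mul, hωq]
  have hDq0 : D ^ q ≠ 0 := pow_ne_zero _ hD0
  have hDqq := hqq D
  -- The cross ratio equation reads `t * D = N` with `N = x * y * z * D ^ q`, so `t` is a unit times
  -- `D ^ q / D`, of norm one.
  obtain ⟨t, ht⟩ : ∃ t, t * D = x * y * z * D ^ q :=
    ⟨x * y * z * D ^ q / D, by field_simp⟩
  have hN : t * D = y * z + ω * (x * z) + ω ^ 2 * (x * y) := by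
    rw [ht, hDq]
    rw [pow_succ] at hx hy hz
    linear_combination y * z * hx + ω * (x * z) * hy + ω ^ 2 * (x * y) * hz
  have hP : (x - z) * (y - t) = ω * ((y - z) * (x - t)) := by
    grind
  have hxz' := sub_ne_zero.2 hxz
  have hxy' := sub_ne_zero.2 hxy
  have hyz' := sub_ne_zero.2 hyz
  refine ⟨t, ?_, ?_, ?_, ?_, hP⟩
  · have h := congrArg (· ^ (q + 1)) ht
    simp only [mul_pow, hx, hy, hz, one_mul] at h
    rw [pow_succ (D ^ q), hDqq, pow_succ D, mul_comm (D ^ q) D] at h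
    exact mul_right_cancel₀ (mul_ne_zero hD0 hDq0) (by rw [h, one_mul])
  · rintro rfl
    rw [sub_self, mul_zero, mul_zero] at hP
    grind
  · rintro rfl
    rw [sub_self, mul_zero] at hP
    exact mul_ne_zero hω0 (mul_ne_zero hyz' hxy') hP.symm
  · rintro rfl
    have : (1 - ω) * ((x - t) * (y - t)) = 0 := by linear_combination hP
    exact mul_ne_zero (sub_ne_zero.2 hω1.symm) (mul_ne_zero hxz' hyz') this

/-- The generalized Vandermonde determinant with exponents `0, 1, 4, 5`. -/
theorem det_pow_zero_one_four_five {R : Type*} [CommRing R] (x y z t : R) :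
    (!![1, 1, 1, 1; x, y, z, t; x ^ 4, y ^ 4, z ^ 4, t ^ 4;
      x ^ 5, y ^ 5, z ^ 5, t ^ 5] : Matrix (Fin 4) (Fin 4) R).det =
    (y - x) * (z - x) * (t - x) * (z - y) * (t - y) * (t - z) *
      ((x * y + x * z + x * t + y * z + y * t + z * t) ^ 2 -
        (x + y + z + t) * (x * y * z + x * y * t + x * z * t + y * z * t)) := by
  simp [Matrix.det_succ_row_zero, Fin.sum_univ_succ, Fin.succAbove]
  ring

/-! ### Facts on the extension of degree two. -/

section FieldFacts

variable {F K : Type*} [Field F] [Field K] [Algebra F K] {m q : ℕ}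

theorem charP_two_of_natCard [Finite K] (hm : m ≠ 0) (hq : q = 2 ^ m) (hK : Nat.card K = q ^ 2) :
    CharP K 2 := by
  have := Fintype.ofFinite K
  have h : ((Nat.card K : ℕ) : K) = 0 := by
    rw [Nat.card_eq_fintype_card, Nat.cast_card_eq_zero]
  rw [hK, hq] at h
  have h2 : (2 : K) = 0 := by simpa [hm] using h
  exact CharTwo.of_one_ne_zero_of_two_eq_zero one_ne_zero h2

theorem pow_natCard_pow_natCard (hK : Nat.card K = q ^ 2) [Finite K] (a : K) :
    (a ^ q) ^ q = a := by
  have := Fintype.ofFinite K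
  rw [← pow_mul, ← sq, ← hK, Nat.card_eq_fintype_card, FiniteField.pow_card]

theorem algebraMap_pow_natCard (hF : Nat.card F = q) [Finite F] (a : F) :
    (algebraMap F K a) ^ q = algebraMap F K a := by
  have := Fintype.ofFinite F
  rw [← map_pow, ← hF, Nat.card_eq_fintype_card, FiniteField.pow_card]

theorem finrank_eq_two_of_natCard (hF : Nat.card F = q) (hK : Nat.card K = q ^ 2) [Finite K]
    (hq : 1 < q) : Module.finrank F K = 2 := by
  have h := Module.natCard_eq_pow_finrank (K := F) (V := K)
  rw [hF, hK] at h
  exact (Nat.pow_right_injective hq h).symm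

theorem algebraMap_trace_eq_add_pow (hF : Nat.card F = q) (hK : Nat.card K = q ^ 2) [Finite K]
    (hq : 1 < q) (a : K) : algebraMap F K (Algebra.trace F K a) = a + a ^ q := by
  rw [FiniteField.algebraMap_trace_eq_sum_pow, finrank_eq_two_of_natCard hF hK hq,
    Finset.sum_range_succ, Finset.sum_range_one, hF, pow_zero, pow_one, pow_one]

theorem natCard_rootsOfUnity_add_one (hK : Nat.card K = q ^ 2) [Finite K] :
    Nat.card (rootsOfUnity (q + 1) K) = q + 1 := by
  have h : rootsOfUnity (q + 1) K = (powMonoidHom (q + 1) : Kˣ →* Kˣ).ker := by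
    ext u
    simp
  rw [h, IsCyclic.card_powMonoidHom_ker, Nat.card_units, hK]
  apply Nat.gcd_eq_right
  exact ⟨q - 1, by simpa using Nat.sq_sub_sq q 1⟩

theorem sum_pow_eq_of_two_pow [CharP K 2] (hq : q = 2 ^ m) {ι : Type*} (s : Finset ι) (f : ι → K) :
    (∑ i ∈ s, f i) ^ q = ∑ i ∈ s, f i ^ q := by
  rw [hq, sum_pow_char_pow 2 m]

theorem exists_primitive_cube_root (hF : Nat.card F = q) [Finite F] (hq : q % 3 = 1) :
    ∃ ω : F, ω ^ 2 + ω + 1 = 0 := by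
  have : Fact (Nat.Prime 3) := ⟨Nat.prime_three⟩
  have hd : 3 ∣ Nat.card Fˣ := by
    rw [Nat.card_units, hF]
    omega
  obtain ⟨u, hu⟩ := exists_prime_orderOf_dvd_card' 3 hd
  refine ⟨u, ?_⟩
  have h3 : (u : F) ^ 3 = 1 := by
    rw [← Units.val_pow_eq_pow_val, ← hu, pow_orderOf_eq_one, Units.val_one]
  have h1 : (u : F) - 1 ≠ 0 := by
    intro h
    have : u = 1 := Units.ext (sub_eq_zero.1 h)
    rw [this, orderOf_one] at hu
    omega
  have : ((u : F) - 1) * ((u : F) ^ 2 + u + 1) = 0 := by linear_combination h3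
  exact (mul_eq_zero.1 this).resolve_left h1

end FieldFacts

/-! ### Membership by power sums, and the minimum distance. -/

section Code

variable {F K : Type*} [Field F] [Field K] [Algebra F K] {q : ℕ}

theorem coe_rootsOfUnity_pow (u : rootsOfUnity (q + 1) K) : ((u : Kˣ) : K) ^ (q + 1) = 1 :=
  (mem_rootsOfUnity' _ _).1 u.2

theorem coe_rootsOfUnity_injective :
    Function.Injective fun u : rootsOfUnity (q + 1) K => ((u : Kˣ) : K) :=
  fun _ _ h => Subtype.ext (Units.ext h)

theorem pow_conj_pow {u : K} (hu : u ^ (q + 1) = 1) {k : ℕ} (hk : k ≤ q + 1) :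
    (u ^ q) ^ k = u ^ (q + 1 - k) := by
  have h1 : u ^ k * u ^ (q + 1 - k) = 1 := by rw [← pow_add, Nat.add_sub_cancel' hk, hu]
  have h2 : (u ^ q) ^ k * u ^ k = 1 := by rw [← mul_pow, ← pow_succ, hu, one_pow]
  linear_combination u ^ (q + 1 - k) * h2 - (u ^ q) ^ k * h1

variable [Fintype (rootsOfUnity (q + 1) K)]

theorem sum_mul_pow_conj (hF : Nat.card F = q) [Finite F] [CharP K 2] {m : ℕ} (hq : q = 2 ^ m)
    {w : rootsOfUnity (q + 1) K → F} {k : ℕ}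
    (h : ∑ u, algebraMap F K (w u) * ((u : Kˣ) : K) ^ k = 0) :
    ∑ u, algebraMap F K (w u) * (((u : Kˣ) : K) ^ q) ^ k = 0 := by
  have h' := congrArg (· ^ q) h
  simp only [sum_pow_eq_of_two_pow hq] at h'
  rw [zero_pow (by rw [hq]; positivity)] at h'
  rw [← h']
  refine Finset.sum_congr rfl fun u _ => ?_
  rw [mul_pow, algebraMap_pow_natCard hF, ← pow_mul, ← pow_mul, mul_comm q k]

theorem mem_subfieldSubcode_dualCode_codeC35 (hF : Nat.card F = q) [Finite F] [CharP K 2] {m : ℕ}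
    (hm : 4 ≤ m) (hq : q = 2 ^ m) {w : rootsOfUnity (q + 1) K → F} :
    w ∈ subfieldSubcode F (dualCode (codeC35 q K)) ↔
      ∑ u, algebraMap F K (w u) * ((u : Kˣ) : K) ^ 3 = 0 ∧
      ∑ u, algebraMap F K (w u) * ((u : Kˣ) : K) ^ 5 = 0 := by
  have hq16 : 16 ≤ q := hq ▸ Nat.pow_le_pow_right (n := 2) two_pos hm
  have hmem : w ∈ subfieldSubcode F (dualCode (codeC35 q K)) ↔
    ∀ c ∈ codeC35 q K, ∑ u, c u * algebraMap F K (w u) = 0 := Iff.rfl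
  rw [hmem]
  constructor
  · intro h
    refine ⟨?_, ?_⟩
    · rw [← h (fun u => ((u : Kˣ) : K) ^ 3) ⟨1, 0, 0, 0, fun u => by ring⟩]
      exact Finset.sum_congr rfl fun u _ => mul_comm _ _
    · rw [← h (fun u => ((u : Kˣ) : K) ^ 5) ⟨0, 0, 1, 0, fun u => by ring⟩]
      exact Finset.sum_congr rfl fun u _ => mul_comm _ _
  · rintro ⟨h3, h5⟩ c ⟨a, a', b, b', hc⟩
    have h3' := sum_mul_pow_conj hF hq h3
    have h5' := sum_mul_pow_conj hF hq h5
    have key : ∑ u, c u * algebraMap F K (w u) =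
        a * ∑ u, algebraMap F K (w u) * ((u : Kˣ) : K) ^ 3 +
        a' * ∑ u, algebraMap F K (w u) * (((u : Kˣ) : K) ^ q) ^ 3 +
        b * ∑ u, algebraMap F K (w u) * ((u : Kˣ) : K) ^ 5 +
        b' * ∑ u, algebraMap F K (w u) * (((u : Kˣ) : K) ^ q) ^ 5 := by
      simp only [Finset.mul_sum, ← Finset.sum_add_distrib]
      refine Finset.sum_congr rfl fun u _ => ?_
      rw [hc u, pow_conj_pow (coe_rootsOfUnity_pow u) (by omega : 3 ≤ q + 1),
        pow_conj_pow (coe_rootsOfUnity_pow u) (by omega : 5 ≤ q + 1),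
        show q + 1 - 3 = q - 2 by omega, show q + 1 - 5 = q - 4 by omega]
      ring
    rw [key, h3, h3', h5, h5']
    ring

theorem four_le_hammingNorm [DecidableEq F] (hF : Nat.card F = q) [Finite F] [CharP K 2] {m : ℕ}
    (hq : q = 2 ^ m) (hq3 : q % 3 = 1) (hcard : 3 ≤ Fintype.card (rootsOfUnity (q + 1) K))
    {w : rootsOfUnity (q + 1) K → F} (hw : w ≠ 0)
    (h3 : ∑ u, algebraMap F K (w u) * ((u : Kˣ) : K) ^ 3 = 0)
    (h5 : ∑ u, algebraMap F K (w u) * ((u : Kˣ) : K) ^ 5 = 0) :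
    4 ≤ hammingNorm w := by
  classical
  by_contra! hlt
  obtain ⟨z, hz⟩ := Function.ne_iff.1 hw
  -- The support is padded to exactly three points; only `w z ≠ 0` is needed.
  obtain ⟨T, hST, hT⟩ := Finset.exists_superset_card_eq (s := {u | w u ≠ 0}) (n := 3)
    (by unfold hammingNorm at hlt; omega) hcard
  have hzT : z ∈ T := hST (by simpa using hz)
  obtain ⟨x, y, hxy, hTe⟩ := Finset.card_eq_two.1
    (show (T.erase z).card = 2 by rw [Finset.card_erase_of_mem hzT, hT])
  have hxz : x ≠ z := (Finset.mem_erase.1 (hTe ▸ Finset.mem_insert_self x {y})).1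
  have hyz : y ≠ z :=
    (Finset.mem_erase.1 (hTe ▸ Finset.mem_insert_of_mem (Finset.mem_singleton_self y))).1
  have hsum : ∀ f : rootsOfUnity (q + 1) K → K, ∑ u, algebraMap F K (w u) * f u =
      algebraMap F K (w x) * f x + algebraMap F K (w y) * f y + algebraMap F K (w z) * f z := by
    intro f
    rw [← Finset.sum_subset (Finset.subset_univ T), ← Finset.sum_erase_add _ _ hzT, hTe,
      Finset.sum_pair hxy]
    intro u _ hu
    have : w u = 0 := by
      by_contra h
      exact hu (hST (by simpa using h))
    rw [this, map_zero, zero_mul]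
  have h3' := sum_mul_pow_conj hF hq h3
  have h5' := sum_mul_pow_conj hF hq h5
  rw [hsum fun u => ((u : Kˣ) : K) ^ 3] at h3
  rw [hsum fun u => (((u : Kˣ) : K) ^ q) ^ 3] at h3'
  rw [hsum fun u => (((u : Kˣ) : K) ^ q) ^ 5] at h5'
  have hsq : ∀ u v : rootsOfUnity (q + 1) K, u ≠ v → ((u : Kˣ) : K) ^ 2 ≠ ((v : Kˣ) : K) ^ 2 :=
    fun u v huv h => huv (coe_rootsOfUnity_injective (CharTwo.sq_injective h))
  have hpow : ∀ u : rootsOfUnity (q + 1) K, (((u : Kˣ) : K) ^ 2) ^ (q + 1) = 1 := fun u => by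
    rw [← pow_mul, mul_comm, pow_mul, coe_rootsOfUnity_pow, one_pow]
  have hx := coe_rootsOfUnity_pow x
  have hy := coe_rootsOfUnity_pow y
  have hz' := coe_rootsOfUnity_pow z
  -- At the points `u ^ 2` with coefficients `w u * u ^ (-5)`, exponents `0, 1, 4` are the sums with
  -- exponents `-5, -3, 3`.
  have hc := eq_zero_of_three_power_sums hq3
    (fun a b => by rw [hq]; exact add_pow_char_pow a b 2 m)
    (a := algebraMap F K (w x) * (((x : Kˣ) : K) ^ q) ^ 5)
    (b := algebraMap F K (w y) * (((y : Kˣ) : K) ^ q) ^ 5)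
    (c := algebraMap F K (w z) * (((z : Kˣ) : K) ^ q) ^ 5)
    (hpow x) (hpow y) (hpow z) (hsq _ _ hxy) (hsq _ _ hxz) (hsq _ _ hyz) h5'
    (by
      rw [← h3']
      have e : ∀ u : K, u ^ (q + 1) = 1 → (u ^ q) ^ 5 * u ^ 2 = (u ^ q) ^ 3 := fun u hu => by
        rw [show (u ^ q) ^ 5 * u ^ 2 = (u ^ q) ^ 3 * (u ^ (q + 1)) ^ 2 by ring, hu]
        ring
      simp only [mul_assoc, e _ hx, e _ hy, e _ hz'])
    (by
      rw [← h3]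
      have e : ∀ u : K, u ^ (q + 1) = 1 → (u ^ q) ^ 5 * (u ^ 2) ^ 4 = u ^ 3 := fun u hu => by
        rw [show (u ^ q) ^ 5 * (u ^ 2) ^ 4 = u ^ 3 * (u ^ (q + 1)) ^ 5 by ring, hu]
        ring
      simp only [mul_assoc, e _ hx, e _ hy, e _ hz'])
  rcases mul_eq_zero.1 hc with h | h
  · exact hz ((map_eq_zero _).1 h)
  · exact (Units.ne_zero (z : Kˣ)) (eq_zero_of_pow_eq_zero (eq_zero_of_pow_eq_zero h))

/-- With `A = (x - z) * (y - t)` and `B = (y - z) * (x - t)`, the symmetric factor of the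
determinant is `A ^ 2 + A * B + B ^ 2` in characteristic two, which vanishes for `A = ω * B`.
Frobenius carries this to the squared points. -/
theorem exists_four_power_sums [CharP K 2] {ω x y z t : K} (hω : ω ^ 2 + ω + 1 = 0)
    (h : (x - z) * (y - t) = ω * ((y - z) * (x - t))) :
    ∃ c : Fin 4 → K, c ≠ 0 ∧ ∀ k ∈ ({0, 1, 4, 5} : Finset ℕ),
      ∑ i, c i * (![x, y, z, t] i ^ 2) ^ k = 0 := by
  have h2 : (2 : K) = 0 := CharTwo.two_eq_zero
  have hcr : (x * y + x * z + x * t + y * z + y * t + z * t) ^ 2 -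
        (x + y + z + t) * (x * y * z + x * y * t + x * z * t + y * z * t) = 0 := by
    grind
  have hsq : (x ^ 2 * y ^ 2 + x ^ 2 * z ^ 2 + x ^ 2 * t ^ 2 + y ^ 2 * z ^ 2 + y ^ 2 * t ^ 2 +
      z ^ 2 * t ^ 2) ^ 2 - (x ^ 2 + y ^ 2 + z ^ 2 + t ^ 2) * (x ^ 2 * y ^ 2 * z ^ 2 +
      x ^ 2 * y ^ 2 * t ^ 2 + x ^ 2 * z ^ 2 * t ^ 2 + y ^ 2 * z ^ 2 * t ^ 2) = 0 := by
    have := congrArg (· ^ 2) hcr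
    simp only [CharTwo.sub_eq_add, CharTwo.add_sq, mul_pow, zero_pow two_ne_zero] at this ⊢
    exact this
  have hdet := det_pow_zero_one_four_five (x ^ 2) (y ^ 2) (z ^ 2) (t ^ 2)
  rw [hsq, mul_zero] at hdet
  obtain ⟨c, hc0, hc⟩ := Matrix.exists_mulVec_eq_zero_iff.2 hdet
  refine ⟨c, hc0, ?_⟩
  have e0 := congrFun hc 0
  have e1 := congrFun hc 1
  have e2 := congrFun hc 2
  have e3 := congrFun hc 3
  simp only [Matrix.mulVec, dotProduct, Fin.sum_univ_four, Matrix.of_apply, Matrix.cons_val,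
    Pi.zero_apply] at e0 e1 e2 e3
  intro k hk
  simp only [Finset.mem_insert, Finset.mem_singleton] at hk
  simp only [Fin.sum_univ_four, Matrix.cons_val]
  rcases hk with rfl | rfl | rfl | rfl
  · linear_combination e0
  · linear_combination e1
  · linear_combination e2
  · linear_combination e3

theorem exists_hammingNorm_le_four [DecidableEq F] (hF : Nat.card F = q) (hK : Nat.card K = q ^ 2)
    [Finite F] [Finite K] [CharP K 2] {m : ℕ} (hm : 1 ≤ m)
    (hq : q = 2 ^ m) (hq3 : q % 3 = 1) (hcard : 3 ≤ Fintype.card (rootsOfUnity (q + 1) K)) :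
    ∃ w : rootsOfUnity (q + 1) K → F, w ≠ 0 ∧ hammingNorm w ≤ 4 ∧
      ∑ u, algebraMap F K (w u) * ((u : Kˣ) : K) ^ 3 = 0 ∧
      ∑ u, algebraMap F K (w u) * ((u : Kˣ) : K) ^ 5 = 0 := by
  classical
  have hq1 : 1 < q := hq ▸ Nat.one_lt_two_pow (by omega)
  obtain ⟨ω₀, hω₀⟩ := exists_primitive_cube_root hF hq3
  have hω : (algebraMap F K ω₀) ^ 2 + algebraMap F K ω₀ + 1 = 0 := by
    rw [← map_pow, ← map_add, ← map_one (algebraMap F K), ← map_add, hω₀, map_zero]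
  obtain ⟨x, y, z, hxy, hxz, hyz⟩ := Fintype.two_lt_card_iff.1 hcard
  obtain ⟨t₀, ht₀, htx, hty, htz, hcr⟩ := exists_cross_ratio_eq
    (fun a b => by rw [hq]; exact add_pow_char_pow a b 2 m) (pow_natCard_pow_natCard hK) hω
    (algebraMap_pow_natCard hF ω₀) (coe_rootsOfUnity_pow x) (coe_rootsOfUnity_pow y)
    (coe_rootsOfUnity_pow z) (coe_rootsOfUnity_injective.ne hxy)
    (coe_rootsOfUnity_injective.ne hxz) (coe_rootsOfUnity_injective.ne hyz)
  obtain ⟨t, ht⟩ : ∃ t : rootsOfUnity (q + 1) K, ((t : Kˣ) : K) = t₀ :=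
    ⟨rootsOfUnity.mkOfPowEq t₀ ht₀, rfl⟩
  rw [← ht] at htx hty htz hcr
  have htx' : t ≠ x := fun h => htx (by rw [h])
  have hty' : t ≠ y := fun h => hty (by rw [h])
  have htz' : t ≠ z := fun h => htz (by rw [h])
  obtain ⟨c, hc0, hc⟩ := exists_four_power_sums hω hcr
  obtain ⟨p, hp⟩ : ∃ p : Fin 4 → rootsOfUnity (q + 1) K, p = ![x, y, z, t] := ⟨_, rfl⟩
  have hpinj : Function.Injective p := by
    intro i j
    rw [hp]
    fin_cases i <;> fin_cases j <;>
      simp [hxy, hxz, hyz, htx', hty', htz', hxy.symm, hxz.symm, hyz.symm, htx'.symm,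
        hty'.symm, htz'.symm]
  have hpc : ∀ i, ![((x : Kˣ) : K), ((y : Kˣ) : K), ((z : Kˣ) : K), ((t : Kˣ) : K)] i =
      ((p i : Kˣ) : K) := by
    intro i
    rw [hp]
    fin_cases i <;> rfl
  simp only [hpc] at hc
  -- The factor `u ^ 5` undoes the shift of exponents, giving a dual word over `K`.
  obtain ⟨d, hd⟩ : ∃ d : Fin 4 → K, d = fun i => c i * ((p i : Kˣ) : K) ^ 5 := ⟨_, rfl⟩
  have hpu : ∀ i, ((p i : Kˣ) : K) ^ (q + 1) = 1 := fun i => coe_rootsOfUnity_pow _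
  have d3 : ∑ i, d i * ((p i : Kˣ) : K) ^ 3 = 0 := by
    rw [← hc 4 (by simp), hd]
    exact Finset.sum_congr rfl fun i _ => by ring
  have d5 : ∑ i, d i * ((p i : Kˣ) : K) ^ 5 = 0 := by
    rw [← hc 5 (by simp), hd]
    exact Finset.sum_congr rfl fun i _ => by ring
  have d3' : ∑ i, d i * (((p i : Kˣ) : K) ^ q) ^ 3 = 0 := by
    rw [← hc 1 (by simp), hd]
    refine Finset.sum_congr rfl fun i _ => ?_
    rw [show c i * ((p i : Kˣ) : K) ^ 5 * (((p i : Kˣ) : K) ^ q) ^ 3 =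
      c i * ((p i : Kˣ) : K) ^ 2 * (((p i : Kˣ) : K) ^ (q + 1)) ^ 3 by ring, hpu]
    ring
  have d5' : ∑ i, d i * (((p i : Kˣ) : K) ^ q) ^ 5 = 0 := by
    rw [← hc 0 (by simp), hd]
    refine Finset.sum_congr rfl fun i _ => ?_
    rw [show c i * ((p i : Kˣ) : K) ^ 5 * (((p i : Kˣ) : K) ^ q) ^ 5 =
      c i * (((p i : Kˣ) : K) ^ (q + 1)) ^ 5 by ring, hpu]
    ring
  obtain ⟨j, hj⟩ := Function.ne_iff.1 hc0
  have hdj : d j ≠ 0 := by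
    rw [hd]
    exact mul_ne_zero hj (pow_ne_zero _ (Units.ne_zero _))
  obtain ⟨θ, hθ⟩ := Algebra.trace_surjective F K 1
  -- Scaling before the trace makes entry `j` equal to `1`, so the descended word is nonzero. The
  -- relations survive because the exponents are closed under negation.
  obtain ⟨v, hv⟩ : ∃ v : Fin 4 → F, v = fun i => Algebra.trace F K (θ / d j * d i) := ⟨_, rfl⟩
  have hvj : v j = 1 := by
    rw [hv]
    simp only
    rw [div_mul_cancel₀ _ hdj, hθ]
  have hvsum : ∀ k : ℕ, ∑ i, d i * ((p i : Kˣ) : K) ^ k = 0 →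
      ∑ i, d i * (((p i : Kˣ) : K) ^ q) ^ k = 0 →
      ∑ i, algebraMap F K (v i) * ((p i : Kˣ) : K) ^ k = 0 := by
    intro k h h'
    have h'' := congrArg (· ^ q) h'
    simp only [sum_pow_eq_of_two_pow hq] at h''
    rw [zero_pow (by omega)] at h''
    have key : ∑ i, algebraMap F K (v i) * ((p i : Kˣ) : K) ^ k =
        (θ / d j) * ∑ i, d i * ((p i : Kˣ) : K) ^ k +
        (θ / d j) ^ q * ∑ i, (d i * (((p i : Kˣ) : K) ^ q) ^ k) ^ q := by
      simp only [Finset.mul_sum, ← Finset.sum_add_distrib]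
      refine Finset.sum_congr rfl fun i _ => ?_
      have e : ((((p i : Kˣ) : K) ^ q) ^ k) ^ q = ((p i : Kˣ) : K) ^ k := by
        rw [← pow_mul, mul_comm k q, pow_mul, pow_natCard_pow_natCard hK]
      rw [hv]
      simp only
      rw [algebraMap_trace_eq_add_pow hF hK hq1, mul_pow, mul_pow, e]
      ring
    rw [key, h, h'', mul_zero, mul_zero, add_zero]
  obtain ⟨w, hw⟩ : ∃ w : rootsOfUnity (q + 1) K → F,
      w = fun u => ∑ i, if p i = u then v i else 0 := ⟨_, rfl⟩
  have hwp : ∀ i, w (p i) = v i := by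
    intro i
    rw [hw]
    simp [hpinj.eq_iff]
  have hwsum : ∀ f : rootsOfUnity (q + 1) K → K,
      ∑ u, algebraMap F K (w u) * f u = ∑ i, algebraMap F K (v i) * f (p i) := by
    intro f
    rw [hw]
    simp only [map_sum, Finset.sum_mul]
    rw [Finset.sum_comm]
    refine Finset.sum_congr rfl fun i _ => ?_
    rw [Finset.sum_eq_single (p i)]
    · simp
    · intro u _ hu
      simp [hu.symm]
    · simp
  refine ⟨w, ?_, ?_, ?_, ?_⟩
  · intro h
    have := hwp j
    rw [h, hvj] at this
    exact zero_ne_one this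
  · calc hammingNorm w ≤ (Finset.univ.image p).card := by
          apply Finset.card_le_card
          intro u hu
          by_contra hn
          apply (Finset.mem_filter.1 hu).2
          rw [hw]
          refine Finset.sum_eq_zero fun i _ => if_neg fun h => hn ?_
          exact h ▸ Finset.mem_image_of_mem p (Finset.mem_univ i)
      _ ≤ 4 := Finset.card_image_le
  · rw [hwsum fun u => ((u : Kˣ) : K) ^ 3]
    exact hvsum 3 d3 d3'
  · rw [hwsum fun u => ((u : Kˣ) : K) ^ 5]
    exact hvsum 5 d5 d5'

end Code

/-! ### The dimension, by surjectivity of the power sum map. -/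

section Dimension

variable {F K : Type*} [Field F] [Field K] [Algebra F K] {q : ℕ}
  [Fintype (rootsOfUnity (q + 1) K)]

variable (F K q) in
/-- The `F`-linear map `w ↦ (∑ u, w u * u ^ 3, ∑ u, w u * u ^ 5)`. -/
noncomputable def powerSumMap : (rootsOfUnity (q + 1) K → F) →ₗ[F] K × K :=
  LinearMap.prod
    (∑ u : rootsOfUnity (q + 1) K, (LinearMap.proj u).smulRight (((u : Kˣ) : K) ^ 3))
    (∑ u : rootsOfUnity (q + 1) K, (LinearMap.proj u).smulRight (((u : Kˣ) : K) ^ 5))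

theorem powerSumMap_apply (w : rootsOfUnity (q + 1) K → F) :
    powerSumMap F K q w = (∑ u, algebraMap F K (w u) * ((u : Kˣ) : K) ^ 3,
      ∑ u, algebraMap F K (w u) * ((u : Kˣ) : K) ^ 5) := by
  simp [powerSumMap, Algebra.smul_def]

theorem exists_trace_mul_eq [Finite K] (f : K →ₗ[F] F) :
    ∃ a : K, ∀ x, f x = Algebra.trace F K (a * x) := by
  have hnd := traceForm_nondegenerate F K
  refine ⟨((Algebra.traceForm F K).toDual hnd).symm f, fun x => ?_⟩
  rw [← Algebra.traceForm_apply, LinearMap.BilinForm.apply_toDual_symm_apply]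

open Polynomial in
theorem eq_zero_of_trace_eq_zero (hF : Nat.card F = q) (hK : Nat.card K = q ^ 2) [Finite K]
    (hq : 16 ≤ q) {a b : K}
    (h : ∀ u : rootsOfUnity (q + 1) K, Algebra.trace F K (a * ((u : Kˣ) : K) ^ 3) +
      Algebra.trace F K (b * ((u : Kˣ) : K) ^ 5) = 0) : a = 0 ∧ b = 0 := by
  -- On the circle `P` is `u ^ 5` times the sum of the two traces, each written `c + c ^ q`.
  obtain ⟨P, hP⟩ : ∃ P : K[X],
      P = C (b ^ q) + C (a ^ q) * X ^ 2 + C a * X ^ 8 + C b * X ^ 10 := ⟨_, rfl⟩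
  have hdeg : P.natDegree ≤ 10 := by
    rw [hP]
    compute_degree
  have heval : ∀ u : rootsOfUnity (q + 1) K, P.eval ((u : Kˣ) : K) = 0 := by
    intro u
    have hu := coe_rootsOfUnity_pow u
    have hu' := congrArg (algebraMap F K) (h u)
    rw [map_add, algebraMap_trace_eq_add_pow hF hK (by omega),
      algebraMap_trace_eq_add_pow hF hK (by omega), map_zero, mul_pow, mul_pow] at hu'
    generalize ((u : Kˣ) : K) = s at *
    rw [← pow_mul, ← pow_mul, mul_comm 3 q, mul_comm 5 q, pow_mul, pow_mul] at hu'
    have e3 : s ^ 5 * (s ^ q) ^ 3 = s ^ 2 := by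
      rw [show s ^ 5 * (s ^ q) ^ 3 = s ^ 2 * (s ^ (q + 1)) ^ 3 by ring, hu]
      ring
    have e5 : s ^ 5 * (s ^ q) ^ 5 = 1 := by
      rw [show s ^ 5 * (s ^ q) ^ 5 = (s ^ (q + 1)) ^ 5 by ring, hu, one_pow]
    rw [hP]
    simp only [eval_add, eval_mul, eval_C, eval_pow, eval_X]
    linear_combination s ^ 5 * hu' - a ^ q * e3 - b ^ q * e5
  have hP0 : P = 0 := by
    refine eq_zero_of_natDegree_lt_card_of_eval_eq_zero P coe_rootsOfUnity_injective heval ?_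
    rw [← Nat.card_eq_fintype_card, natCard_rootsOfUnity_add_one hK]
    omega
  have c8 := congrArg (fun p => coeff p 8) hP0
  have c10 := congrArg (fun p => coeff p 10) hP0
  simp only [hP, coeff_add, coeff_C_mul, coeff_C, coeff_X_pow, coeff_zero] at c8 c10
  norm_num at c8 c10
  exact ⟨c8, c10⟩

theorem powerSumMap_surjective (hF : Nat.card F = q) (hK : Nat.card K = q ^ 2) [Finite K]
    (hq : 16 ≤ q) : Function.Surjective (powerSumMap F K q) := by
  classical
  rw [← LinearMap.range_eq_top]
  by_contra hne
  -- A proper image lies in the kernel of a nonzero functional, which is a pair of trace forms.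
  obtain ⟨f, hf0, hf⟩ := Submodule.exists_le_ker_of_lt_top _ (lt_top_iff_ne_top.2 hne)
  obtain ⟨a, ha⟩ := exists_trace_mul_eq (f ∘ₗ LinearMap.inl F K K)
  obtain ⟨b, hb⟩ := exists_trace_mul_eq (f ∘ₗ LinearMap.inr F K K)
  have hab : ∀ x y, f (x, y) = Algebra.trace F K (a * x) + Algebra.trace F K (b * y) := by
    intro x y
    rw [← ha, ← hb, LinearMap.comp_apply, LinearMap.comp_apply, ← map_add]
    simp
  obtain ⟨rfl, rfl⟩ : a = 0 ∧ b = 0 := by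
    refine eq_zero_of_trace_eq_zero hF hK hq fun u => ?_
    have := hf (LinearMap.mem_range_self (powerSumMap F K q) (Pi.single u 1))
    rw [LinearMap.mem_ker, powerSumMap_apply, hab] at this
    simpa [Pi.single_apply, apply_ite (algebraMap F K), ite_mul] using this
  exact hf0 (LinearMap.ext fun p => by rw [← Prod.mk.eta (p := p), hab]; simp)

theorem finrank_ker_powerSumMap (hF : Nat.card F = q) (hK : Nat.card K = q ^ 2) [Finite K]
    (hq : 16 ≤ q) : Module.finrank F (LinearMap.ker (powerSumMap F K q)) = q - 3 := by
  have h := LinearMap.finrank_range_add_finrank_ker (powerSumMap F K q)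
  rw [LinearMap.range_eq_top.2 (powerSumMap_surjective hF hK hq), finrank_top,
    Module.finrank_prod, finrank_eq_two_of_natCard hF hK (by omega),
    Module.finrank_fintype_fun_eq_card, ← Nat.card_eq_fintype_card,
    natCard_rootsOfUnity_add_one hK] at h
  omega

end Dimension

theorem mainTheorem3 (m q : ℕ) (hm : 4 ≤ m) (hm_even : Even m) (hq : q = 2 ^ m)
    (F K : Type*) [Field F] [DecidableEq F] [Field K] [Algebra F K]
    [Fintype (rootsOfUnity (q + 1) K)]
    (hF : Nat.card F = q) (hK : Nat.card K = q ^ 2) :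
    HasParameters (subfieldSubcode F (dualCode (codeC35 q K))) (q + 1) (q - 3) 4 q := by
  have hq16 : 16 ≤ q := hq ▸ Nat.pow_le_pow_right (n := 2) two_pos hm
  have hq3 : q % 3 = 1 := by
    obtain ⟨k, rfl⟩ := hm_even
    rw [hq, ← two_mul, pow_mul, Nat.pow_mod]
    simp
  have : Finite F := Nat.finite_of_card_ne_zero (by omega)
  have : Finite K := Nat.finite_of_card_ne_zero (by rw [hK]; positivity)
  have : CharP K 2 := charP_two_of_natCard (by omega) hq hK
  have hcard : Fintype.card (rootsOfUnity (q + 1) K) = q + 1 := by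
    rw [← Nat.card_eq_fintype_card, natCard_rootsOfUnity_add_one hK]
  have hmem := @mem_subfieldSubcode_dualCode_codeC35 F K _ _ _ q _ hF _ _ m hm hq
  have hker : subfieldSubcode F (dualCode (codeC35 q K)) = LinearMap.ker (powerSumMap F K q) := by
    ext w
    rw [hmem, LinearMap.mem_ker, powerSumMap_apply, Prod.mk_eq_zero]
  have hlow : ∀ w ∈ subfieldSubcode F (dualCode (codeC35 q K)), w ≠ 0 → 4 ≤ hammingNorm w := by
    intro w hw hw0
    obtain ⟨h3, h5⟩ := hmem.1 hw
    exact four_le_hammingNorm hF hq hq3 (by omega) hw0 h3 h5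
  refine ⟨hF, hcard, ?_, ?_, ?_⟩
  · rw [hker, finrank_ker_powerSumMap hF hK hq16]
  · obtain ⟨w, hw0, hw4, h3, h5⟩ := exists_hammingNorm_le_four hF hK (by omega) hq hq3
      (by omega : 3 ≤ Fintype.card (rootsOfUnity (q + 1) K))
    have hwmem := hmem.2 ⟨h3, h5⟩
    refine ⟨w, hwmem, 0, Submodule.zero_mem _, hw0, ?_⟩
    rw [hammingDist_zero_right]
    exact le_antisymm hw4 (hlow w hwmem hw0)
  · rintro δ ⟨x, hx, y, hy, hxy, rfl⟩
    rw [hammingDist_eq_hammingNorm]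
    exact hlow _ (Submodule.add_mem _ (Submodule.neg_mem _ hx) hy) (neg_add_eq_zero.not.2 hxy)
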